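/- Let $\mathbb{K}$ be a field of characteristic $0$ with algebraic closure $\overline{\mathbb{K}}$. For a commutative ring $R$, let $R^{\mathrm{fr}}((t))$ denote the ring of fractional Laurent series (Puiseux series) $\sum_{n\ge n_0} a_n t^{n/d}$ with $a_n\in R$, $n_0\in\mathbb{Z}$ and $d\in\mathbb{N}\setminus\{0\}$ (both depending on the series), and let $R^{\mathrm{fr}}[[t]]$ be the subring of the series in which no negative exponent occurs (fractional power series). A series $U\in R^{\mathrm{fr}}((t))$ is *finite at $t=0$* if no negative exponent occurs in it, and *vanishes at $t=0$* if only positive exponents occur in it (in particular $U=0$ vanishes at $t=0$). There are natural inclusions $\mathbb{K}^{\mathrm{fr}}[[t]][u]\subset \mathbb{K}[u]^{\mathrm{fr}}[[t]]\subset\mathbb{K}[[u]]^{\mathrm{fr}}[[t]]$. Let $\Delta(t,u)\in\mathbb{K}^{\mathrm{fr}}[[t]][u]$ be a non-zero polynomial in $u$ with coefficients in $\mathbb{K}^{\mathrm{fr}}[[t]]$. Then: 1. The roots of $\Delta(t,\cdot)$ belong to $\overline{\mathbb{K}}^{\mathrm{fr}}((t))$; that is, $\Delta$ splits into factors of degree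 at most $1$ in $u$ over the field $\overline{\mathbb{K}}^{\mathrm{fr}}((t))$. 2. If $\Delta$ has a square root in $\mathbb{K}[[u]]^{\mathrm{fr}}[[t]]$ (that is, $\Delta=\delta^2$ for some $\delta\in\mathbb{K}[[u]]^{\mathrm{fr}}[[t]]$), then every root $U\in\overline{\mathbb{K}}^{\mathrm{fr}}((t))$ of $\Delta$ that vanishes at $t=0$ has even multiplicity in $\Delta$. 3. If $\Delta$ has a square root in $\mathbb{K}[u]^{\mathrm{fr}}[[t]]$, then every root $U\in\overline{\mathbb{K}}^{\mathrm{fr}}((t))$ of $\Delta$ that is finite at $t=0$ has even multiplicity in $\Delta$. -/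

import Mathlib

namespace FractionalSeries

/-- A formal sum `∑ a_q t^q` with rational exponents has a common denominator: there is `d ≥ 1`
such that every exponent that occurs is of the form `n / d` with `n` an integer. Since the support
of a Hahn series is well-ordered, such a series is of the form `∑_{n ≥ n₀} a_n t^(n/d)`. -/
def HasCommonDenominator {R : Type*} [CommRing R] (x : HahnSeries ℚ R) : Prop :=
  ∃ d : ℕ, 0 < d ∧ ∀ q : ℚ, x.coeff q ≠ 0 → ∃ n : ℤ, q = (n : ℚ) / (d : ℚ)

section Closure

variable {R : Type*} [CommRing R]

theorem HasCommonDenominator.single_zero (a : R) :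
    HasCommonDenominator (HahnSeries.C a : HahnSeries ℚ R) := by
  refine ⟨1, one_pos, fun q hq => ⟨0, ?_⟩⟩
  by_contra h
  refine hq ?_
  rw [HahnSeries.C_apply]
  exact HahnSeries.coeff_single_of_ne (by simpa using h)

theorem HasCommonDenominator.add {x y : HahnSeries ℚ R} (hx : HasCommonDenominator x)
    (hy : HasCommonDenominator y) : HasCommonDenominator (x + y) := by
  obtain ⟨d, hd, hx⟩ := hx
  obtain ⟨e, he, hy⟩ := hy
  have hd' : (d : ℚ) ≠ 0 := by exact_mod_cast hd.ne'
  have he' : (e : ℚ) ≠ 0 := by exact_mod_cast he.ne'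
  refine ⟨d * e, Nat.mul_pos hd he, fun q hq => ?_⟩
  by_cases h : x.coeff q = 0
  · obtain ⟨n, rfl⟩ := hy q (fun h' => hq (by simp [h, h']))
    exact ⟨n * d, by push_cast; field_simp⟩
  · obtain ⟨n, rfl⟩ := hx q h
    exact ⟨n * e, by push_cast; field_simp⟩

theorem HasCommonDenominator.neg {x : HahnSeries ℚ R} (hx : HasCommonDenominator x) :
    HasCommonDenominator (-x) := by
  obtain ⟨d, hd, hx⟩ := hx
  exact ⟨d, hd, fun q hq => hx q (fun h => hq (by simp [h]))⟩

theorem exists_of_coeff_mul_ne_zero {x y : HahnSeries ℚ R} {q : ℚ} (hq : (x * y).coeff q ≠ 0) :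
    ∃ a b : ℚ, x.coeff a ≠ 0 ∧ y.coeff b ≠ 0 ∧ a + b = q := by
  obtain ⟨a, ha, b, hb, h⟩ := Set.mem_add.1 (HahnSeries.support_mul_subset
    ((HahnSeries.mem_support _ _).2 hq))
  exact ⟨a, b, ha, hb, h⟩

theorem HasCommonDenominator.mul {x y : HahnSeries ℚ R} (hx : HasCommonDenominator x)
    (hy : HasCommonDenominator y) : HasCommonDenominator (x * y) := by
  obtain ⟨d, hd, hx⟩ := hx
  obtain ⟨e, he, hy⟩ := hy
  have hd' : (d : ℚ) ≠ 0 := by exact_mod_cast hd.ne'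
  have he' : (e : ℚ) ≠ 0 := by exact_mod_cast he.ne'
  refine ⟨d * e, Nat.mul_pos hd he, fun q hq => ?_⟩
  obtain ⟨a, b, ha, hb, rfl⟩ := exists_of_coeff_mul_ne_zero hq
  obtain ⟨n, rfl⟩ := hx a ha
  obtain ⟨m, rfl⟩ := hy b hb
  exact ⟨n * e + m * d, by push_cast; field_simp⟩

end Closure

/-- The ring `R^fr((t))` of fractional Laurent series (Puiseux series) in `t` over `R`. -/
def FracLaurent (R : Type*) [CommRing R] : Subring (HahnSeries ℚ R) where
  carrier := {x | HasCommonDenominator x}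
  mul_mem' := HasCommonDenominator.mul
  one_mem' := by simpa using HasCommonDenominator.single_zero (1 : R)
  add_mem' := HasCommonDenominator.add
  zero_mem' := by simpa using HasCommonDenominator.single_zero (0 : R)
  neg_mem' := HasCommonDenominator.neg

/-- The ring `R^fr[[t]]` of fractional power series in `t` over `R`: the fractional Laurent series
that have no negative exponent. -/
def FracPower (R : Type*) [CommRing R] : Subring (HahnSeries ℚ R) where
  carrier := {x | HasCommonDenominator x ∧ ∀ q : ℚ, q < 0 → x.coeff q = 0}
  mul_mem' := by
    rintro x y ⟨hx, hx0⟩ ⟨hy, hy0⟩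
    refine ⟨hx.mul hy, fun q hq => ?_⟩
    by_contra h
    obtain ⟨a, b, ha, hb, rfl⟩ := exists_of_coeff_mul_ne_zero h
    have h1 : 0 ≤ a := le_of_not_gt fun h => ha (hx0 a h)
    have h2 : 0 ≤ b := le_of_not_gt fun h => hb (hy0 b h)
    linarith
  one_mem' := by
    refine ⟨by simpa using HasCommonDenominator.single_zero (1 : R), fun q hq => ?_⟩
    simp [HahnSeries.coeff_one, hq.ne]
  add_mem' := by
    rintro x y ⟨hx, hx0⟩ ⟨hy, hy0⟩
    exact ⟨hx.add hy, fun q hq => by simp [hx0 q hq, hy0 q hq]⟩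
  zero_mem' := ⟨by simpa using HasCommonDenominator.single_zero (0 : R), fun q _ => by simp⟩
  neg_mem' := by
    rintro x ⟨hx, hx0⟩
    exact ⟨hx.neg, fun q hq => by simp [hx0 q hq]⟩

theorem fracPower_le_fracLaurent (R : Type*) [CommRing R] : FracPower R ≤ FracLaurent R :=
  fun _ hx => hx.1

/-- The inverse (in the field of Hahn series) of a Puiseux series over a field is a Puiseux
series. -/
theorem inv_mem_fracLaurent {K : Type*} [Field K] {x : HahnSeries ℚ K} (hx : x ∈ FracLaurent K) :
    x⁻¹ ∈ FracLaurent K := by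
  obtain ⟨d, hd, hx⟩ := hx
  have hd' : (0 : ℚ) < d := by exact_mod_cast hd
  let f : ℤ →+ ℚ :=
    { toFun := fun n => (n : ℚ) / (d : ℚ)
      map_zero' := by simp
      map_add' := fun a b => by push_cast; ring }
  have hle : ∀ g g' : ℤ, f g ≤ f g' ↔ g ≤ g' := fun g g' => by
    change (g : ℚ) / (d : ℚ) ≤ (g' : ℚ) / (d : ℚ) ↔ g ≤ g'
    rw [div_le_div_iff_of_pos_right hd', Int.cast_le]
  have hinj : Function.Injective f := fun a b h =>
    le_antisymm ((hle a b).1 h.le) ((hle b a).1 h.ge)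
  let y : HahnSeries ℤ K :=
    { coeff := fun n => x.coeff (f n)
      isPWO_support' := by
        refine Set.IsWF.isPWO ?_
        rw [Set.isWF_iff_no_descending_seq]
        intro s hs hmem
        have hw := Set.isWF_iff_no_descending_seq.1 x.isPWO_support.isWF (fun n => f (s n))
          (fun a b hab => lt_of_not_ge fun h => (hs hab).not_ge ((hle _ _).1 h))
        exact hw fun n => hmem n }
  have hxy : HahnSeries.embDomainRingHom f hinj hle y = x := by
    ext q
    by_cases hq : x.coeff q = 0
    · rw [hq]
      by_cases hr : q ∈ Set.range f
      · obtain ⟨n, rfl⟩ := hr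
        exact (HahnSeries.embDomain_coeff (f := ⟨⟨f, hinj⟩, hle _ _⟩)).trans hq
      · exact HahnSeries.embDomain_of_notMem_range (f := ⟨⟨f, hinj⟩, hle _ _⟩) hr
    · obtain ⟨n, rfl⟩ := hx q hq
      exact HahnSeries.embDomain_coeff (f := ⟨⟨f, hinj⟩, hle _ _⟩)
  refine ⟨d, hd, fun q hq => ?_⟩
  rw [← hxy, ← map_inv₀] at hq
  by_contra hn
  refine hq (HahnSeries.embDomain_of_notMem_range (f := ⟨⟨f, hinj⟩, hle _ _⟩) ?_)
  rintro ⟨n, rfl⟩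
  exact hn ⟨n, rfl⟩

/-- Puiseux series over a field form a field. -/
noncomputable instance instFieldFracLaurent (K : Type*) [Field K] : Field (FracLaurent K) where
  inv x := ⟨(x : HahnSeries ℚ K)⁻¹, inv_mem_fracLaurent x.2⟩
  exists_pair_ne := ⟨0, 1, fun h => zero_ne_one (congrArg Subtype.val h)⟩
  mul_inv_cancel x hx := Subtype.ext (mul_inv_cancel₀ fun h => hx (Subtype.ext h))
  inv_zero := Subtype.ext inv_zero
  nnqsmul := _
  nnqsmul_def := fun _ _ => rfl
  qsmul := _
  qsmul_def := fun _ _ => rfl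

/-- Applying a ring homomorphism to each coefficient of a fractional power series:
`∑ a_q t^q ↦ ∑ f(a_q) t^q`. -/
noncomputable def FracPower.map {R S : Type*} [CommRing R] [CommRing S] (f : R →+* S) :
    FracPower R →+* FracPower S where
  toFun x := ⟨(x : HahnSeries ℚ R).map f, by
    obtain ⟨x, ⟨d, hd, hx⟩, hx0⟩ := x
    refine ⟨⟨d, hd, fun q hq => hx q fun h => hq ?_⟩, fun q hq => ?_⟩
    · simp [h]
    · simp [hx0 q hq]⟩
  map_one' := Subtype.ext (by ext q; by_cases h : q = 0 <;> simp [HahnSeries.coeff_one, h])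
  map_mul' x y := Subtype.ext (HahnSeries.map_mul (f : R →ₙ+* S))
  map_zero' := Subtype.ext (by ext q; simp)
  map_add' x y := Subtype.ext (by ext q; simp)

/-- The constant series (in `t`) with value `a`. -/
noncomputable def FracPower.const {R : Type*} [CommRing R] (a : R) : FracPower R :=
  ⟨HahnSeries.C a, HasCommonDenominator.single_zero a, fun q hq => by
    rw [HahnSeries.C_apply]
    exact HahnSeries.coeff_single_of_ne hq.ne⟩

/-- The inclusion of `K^fr[[t]]` into `L^fr((t))` for a field extension `L` of `K`. -/
noncomputable def toFracLaurent (K L : Type*) [Field K] [Field L] [Algebra K L] :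
    FracPower K →+* FracLaurent L :=
  (Subring.inclusion (fracPower_le_fracLaurent L)).comp (FracPower.map (algebraMap K L))

/-- The inclusion `R^fr[[t]][u] ⊂ R[u]^fr[[t]]`. -/
noncomputable def toPolySeries (R : Type*) [CommRing R] :
    Polynomial (FracPower R) →+* FracPower (Polynomial R) :=
  Polynomial.eval₂RingHom (FracPower.map Polynomial.C) (FracPower.const Polynomial.X)

/-- The inclusion `R^fr[[t]][u] ⊂ R[[u]]^fr[[t]]`. -/
noncomputable def toPowerSeriesSeries (R : Type*) [CommRing R] :
    Polynomial (FracPower R) →+* FracPower (PowerSeries R) :=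
  (FracPower.map Polynomial.coeToPowerSeries.ringHom).comp (toPolySeries R)

/-- The coefficient of `t^q u^n` is the same in `R^fr[[t]][u]` and in `R[u]^fr[[t]]`. -/
theorem coeff_toPolySeries {R : Type*} [CommRing R] (p : Polynomial (FracPower R)) (q : ℚ)
    (n : ℕ) :
    ((toPolySeries R p : HahnSeries ℚ (Polynomial R)).coeff q).coeff n =
      (p.coeff n : HahnSeries ℚ R).coeff q := by
  induction p using Polynomial.induction_on' with
  | add p r hp hr => simp [hp, hr]
  | monomial m a =>
    have h : (toPolySeries R (Polynomial.monomial m a) : HahnSeries ℚ (Polynomial R)) =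
        (a : HahnSeries ℚ R).map (Polynomial.C : R →+* Polynomial R) *
          HahnSeries.single 0 (Polynomial.X ^ m) := by
      simp [toPolySeries, FracPower.const, FracPower.map]
    rw [h, HahnSeries.coeff_mul_single_zero, HahnSeries.map_coeff, Polynomial.coeff_C_mul,
      Polynomial.coeff_X_pow, Polynomial.coeff_monomial]
    by_cases hmn : n = m
    · simp [hmn]
    · simp [hmn, Ne.symm hmn]

/-- The coefficient of `t^q u^n` is the same in `R^fr[[t]][u]` and in `R[[u]]^fr[[t]]`. -/
theorem coeff_toPowerSeriesSeries {R : Type*} [CommRing R] (p : Polynomial (FracPower R)) (q : ℚ)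
    (n : ℕ) :
    PowerSeries.coeff n ((toPowerSeriesSeries R p : HahnSeries ℚ (PowerSeries R)).coeff q) =
      (p.coeff n : HahnSeries ℚ R).coeff q := by
  rw [← coeff_toPolySeries]
  exact Polynomial.coeff_coe _ _

/-- `U` is finite at `t = 0`: no negative exponent of `t` occurs in `U`. -/
def FiniteAtZero {R : Type*} [CommRing R] (U : FracLaurent R) : Prop :=
  ∀ q : ℚ, q < 0 → (U : HahnSeries ℚ R).coeff q = 0

/-- `U` vanishes at `t = 0`: only positive exponents of `t` occur in `U`. -/
def VanishesAtZero {R : Type*} [CommRing R] (U : FracLaurent R) : Prop :=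
  ∀ q : ℚ, q ≤ 0 → (U : HahnSeries ℚ R).coeff q = 0

end FractionalSeries

open FractionalSeries

/-!
Newton–Puiseux. Let `P = u ^ n + ⋯` be monic and irreducible over `L^fr((t))`, where `L` is
algebraically closed of characteristic zero. A Tschirnhaus shift removes the coefficient of
`u ^ (n - 1)`. If `P` were not `u ^ n`, rescaling `u` by `t ^ r`, where `r` is the least of the
Newton slopes `ord (coeff P i) / (n - i)`, would give a polynomial over some `L⟦t^(1/d)⟧` whose
reduction at `t = 0` is not `u ^ n` either. But over a complete local ring the reduction of a monic
irreducible polynomial that has a root `a` is `(u - a) ^ n`, by Weierstrass preparation at `a`; the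
missing coefficient forces `a = 0`, a contradiction.

Even multiplicities. If `U` vanishes at `t = 0`, then `u - U` is a distinguished polynomial, so by
Weierstrass division the power series ring in `u` modulo `(u - U) ^ k` is the polynomial ring modulo
`(u - U) ^ k`. Hence `u - U` stays prime among power series and keeps its multiplicity in
`Δ = δ ^ 2`, which is twice its multiplicity in `δ`. A root that is merely finite is moved to one
that vanishes by translating `u` by `U(0)`, which is possible when `δ` is polynomial in `u` at each
power of `t`.
-/

namespace FractionalSeries

open Polynomial
open scoped PowerSeries

section Weierstrass

variable {A : Type*} [CommRing A] {I : Ideal A}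

theorem isDistinguishedAt_X_sub_C {U : A} (hU : U ∈ I) :
    (X - C U).IsDistinguishedAt I where
  mem {n} hn := by
    obtain rfl : n = 0 := Nat.lt_one_iff.1 (hn.trans_le (natDegree_X_sub_C_le U))
    simpa using hU
  monic := monic_X_sub_C U

variable [IsAdicComplete I A] {g : A[X]}

theorem coe_dvd_coe_iff_of_isDistinguishedAt (hg : g.IsDistinguishedAt I) {f : A[X]} :
    (g : A⟦X⟧) ∣ f ↔ g ∣ f := by
  rw [← Ideal.Quotient.eq_zero_iff_dvd, ← Ideal.Quotient.eq_zero_iff_dvd,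
    ← EmbeddingLike.map_eq_zero_iff (f := hg.algEquivQuotient)]
  simp

theorem prime_coe_of_isDistinguishedAt (hg : g.IsDistinguishedAt I) (hp : Prime g) :
    Prime (g : A⟦X⟧) := by
  have : (Ideal.span {g}).IsPrime := (Ideal.span_singleton_prime hp.ne_zero).2 hp
  have : IsDomain (A⟦X⟧ ⧸ Ideal.span {(g : A⟦X⟧)}) := hg.algEquivQuotient.symm.toMulEquiv.isDomain
  exact (Ideal.span_singleton_prime (coe_injective A |>.ne hp.ne_zero)).1
    ((Ideal.Quotient.isDomain_iff_prime _).1 this)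

theorem emultiplicity_coe_of_isDistinguishedAt (hg : g.IsDistinguishedAt I) (f : A[X]) :
    emultiplicity (g : A⟦X⟧) f = emultiplicity g f := by
  refine emultiplicity_eq_emultiplicity_iff.2 fun n => ?_
  have hpow : (g ^ n).IsDistinguishedAt I := by
    induction n with
    | zero => exact ⟨⟨fun h => by simp at h⟩, by simp⟩
    | succ n ih => rw [pow_succ]; exact ih.mul hg
  rw [← coe_pow, coe_dvd_coe_iff_of_isDistinguishedAt hpow]

theorem even_rootMultiplicity_of_sq_eq_coe [IsDomain A] {P : A[X]} (hP : P ≠ 0) {δ : A⟦X⟧}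
    (hδ : δ ^ 2 = P) {U : A} (hU : U ∈ I) : Even (P.rootMultiplicity U) := by
  classical
  have hg := isDistinguishedAt_X_sub_C hU
  have hprime := prime_coe_of_isDistinguishedAt hg (prime_X_sub_C U)
  have hmul := emultiplicity_coe_of_isDistinguishedAt hg P
  have hfin : FiniteMultiplicity ((X - C U : A[X]) : A⟦X⟧) δ := by
    refine FiniteMultiplicity.mul_right (b := δ) ?_
    rw [← sq, hδ, finiteMultiplicity_iff_emultiplicity_ne_top, hmul]
    exact finiteMultiplicity_iff_emultiplicity_ne_top.1 (finiteMultiplicity_X_sub_C U hP)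
  rw [rootMultiplicity_eq_multiplicity, if_neg hP, ← multiplicity_eq_of_emultiplicity_eq hmul,
    ← hδ, FiniteMultiplicity.multiplicity_pow hprime hfin]
  exact even_two_mul _

end Weierstrass

section Tschirnhaus

variable {R : Type*} [CommRing R]

theorem nextCoeff_taylor (c : R) (P : R[X]) :
    (taylor c P).nextCoeff = P.nextCoeff + P.natDegree * P.leadingCoeff * c := by
  obtain hn | hn := Nat.eq_zero_or_pos P.natDegree
  · simp [nextCoeff, hn]
  have hd : (hasseDeriv (P.natDegree - 1) P).natDegree < 2 :=
    (natDegree_hasseDeriv_le P _).trans_lt (by omega)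
  have hchoose : P.natDegree.choose (P.natDegree - 1) = P.natDegree :=
    (Nat.choose_symm hn).trans (Nat.choose_one_right _)
  rw [nextCoeff_of_natDegree_pos (by rwa [natDegree_taylor]), natDegree_taylor, taylor_coeff,
    eval_eq_sum_range' hd, Finset.sum_range_succ, Finset.sum_range_one, hasseDeriv_coeff,
    hasseDeriv_coeff, Nat.add_sub_cancel' hn, hchoose, nextCoeff_of_natDegree_pos hn,
    coeff_natDegree]
  simp

theorem exists_nextCoeff_taylor_eq_zero {F : Type*} [Field F] {P : F[X]}
    (hdeg : (P.natDegree : F) ≠ 0) : ∃ c, (taylor c P).nextCoeff = 0 := by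
  have hlead : P.leadingCoeff ≠ 0 := fun h => hdeg (by simp [leadingCoeff_eq_zero.1 h])
  refine ⟨-P.nextCoeff / (P.natDegree * P.leadingCoeff), ?_⟩
  rw [nextCoeff_taylor, mul_div_cancel₀ _ (mul_ne_zero hdeg hlead), add_neg_cancel]

theorem rootMultiplicity_taylor (P : R[X]) (c x : R) :
    (taylor c P).rootMultiplicity (x - c) = P.rootMultiplicity x := by
  simpa [taylor_apply] using rootMultiplicity_comp_C_mul_X_add_C P 1 c (x - c) isUnit_one

theorem irreducible_taylor_iff {P : R[X]} {c : R} :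
    Irreducible (taylor c P) ↔ Irreducible P :=
  MulEquiv.irreducible_iff (taylorEquiv c)

theorem nextCoeff_scaleRoots (P : R[X]) (s : R) :
    (P.scaleRoots s).nextCoeff = P.nextCoeff * s := by
  obtain hn | hn := Nat.eq_zero_or_pos P.natDegree
  · simp [nextCoeff, hn]
  · rw [nextCoeff_of_natDegree_pos (by rwa [natDegree_scaleRoots]), natDegree_scaleRoots,
      coeff_scaleRoots, Nat.sub_sub_self hn, pow_one, nextCoeff_of_natDegree_pos hn]

theorem irreducible_scaleRoots_iff [IsDomain R] {P : R[X]} {s : R} (hs : IsUnit s) :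
    Irreducible (P.scaleRoots s) ↔ Irreducible P := by
  obtain ⟨s, rfl⟩ := hs
  let e : R[X] ≃* R[X] :=
    { toFun := (scaleRoots · s)
      invFun := (scaleRoots · ↑s⁻¹)
      left_inv := fun p => by simp [← scaleRoots_mul]
      right_inv := fun p => by simp [← scaleRoots_mul]
      map_mul' := fun p q => mul_scaleRoots_of_noZeroDivisors p q s }
  exact MulEquiv.irreducible_iff e

end Tschirnhaus

section Hensel

variable {A : Type*} [CommRing A] [IsLocalRing A] [IsAdicComplete (IsLocalRing.maximalIdeal A) A]

open IsLocalRing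

theorem map_residue_eq_X_pow_of_irreducible {P : A[X]} (hP : P.Monic) (hirr : Irreducible P)
    (h0 : (P.map (residue A)).IsRoot 0) : P.map (residue A) = X ^ P.natDegree := by
  have hP0 : (P : A⟦X⟧).map (residue A) ≠ 0 := by
    rw [← polynomial_map_coe]
    exact coe_eq_zero_iff.not.2 (hP.map _).ne_zero
  obtain ⟨g, h, hgh⟩ := PowerSeries.exists_isWeierstrassFactorization hP0
  have hg := hgh.isDistinguishedAt
  obtain ⟨q, hq⟩ := (coe_dvd_coe_iff_of_isDistinguishedAt hg).1 ⟨h, hgh.eq_mul⟩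
  have hg_ne_one : g ≠ 1 := by
    rintro rfl
    have hu : IsUnit (P.coeff 0) := by
      rw [← constantCoeff_coe, hgh.eq_mul, coe_one, one_mul]
      exact hgh.isUnit.map _
    rw [zero_isRoot_iff_coeff_zero_eq_zero, coeff_map] at h0
    exact (residue_ne_zero_iff_isUnit _).2 hu h0
  have hq_one : q = 1 := (hg.monic.of_mul_monic_left (hq ▸ hP)).eq_one_of_isUnit <|
    (hirr.isUnit_or_isUnit hq).resolve_left fun hu => hg_ne_one (hg.monic.eq_one_of_isUnit hu)
  rw [hq, hq_one, mul_one]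
  exact hg.map_eq_X_pow

theorem map_residue_eq_X_sub_C_pow_of_irreducible {P : A[X]} (hP : P.Monic) (hirr : Irreducible P)
    {a : ResidueField A} (ha : (P.map (residue A)).IsRoot a) :
    P.map (residue A) = (X - C a) ^ P.natDegree := by
  obtain ⟨a, rfl⟩ := residue_surjective a
  have h := map_residue_eq_X_pow_of_irreducible (P := taylor a P)
    ((leadingCoeff_taylor _ _).trans hP) (irreducible_taylor_iff.2 hirr)
    (by simpa [map_taylor, taylor_eval] using ha)
  refine taylor_injective (residue A a) ?_
  rw [← map_taylor, h, natDegree_taylor]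
  simp [taylor_apply]

theorem map_residue_eq_X_pow_of_nextCoeff_eq_zero [IsAlgClosed (ResidueField A)] {P : A[X]}
    (hP : P.Monic) (hirr : Irreducible P) (hdeg : (P.natDegree : ResidueField A) ≠ 0)
    (hnext : P.nextCoeff = 0) : P.map (residue A) = X ^ P.natDegree := by
  obtain ⟨a, ha⟩ := IsAlgClosed.exists_root (P.map (residue A)) <| by
    rw [hP.degree_map]
    exact (hP.degree_pos_of_not_isUnit hirr.not_isUnit).ne'
  have hpow := map_residue_eq_X_sub_C_pow_of_irreducible hP hirr ha
  have ha0 : a = 0 := by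
    have h : residue A P.nextCoeff = P.natDegree • -a := by
      rw [← nextCoeff_map_eq_of_isUnit_leadingCoeff _ (by simp [hP.leadingCoeff]), hpow,
        (monic_X_sub_C a).nextCoeff_pow, nextCoeff_X_sub_C]
    simpa [hnext, hdeg] using h
  simpa only [ha0, C_0, sub_zero] using hpow

instance isAdicComplete_maximalIdeal_powerSeries {L : Type*} [Field L] :
    IsAdicComplete (maximalIdeal L⟦X⟧) L⟦X⟧ := by
  rw [PowerSeries.maximalIdeal_eq_span_X]
  infer_instance

theorem map_constantCoeff_eq_X_pow_of_irreducible {L : Type*} [Field L] [IsAlgClosed L]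
    {P : L⟦X⟧[X]} (hP : P.Monic) (hirr : Irreducible P) (hdeg : (P.natDegree : L) ≠ 0)
    (hnext : P.nextCoeff = 0) : P.map PowerSeries.constantCoeff = X ^ P.natDegree := by
  have : IsAlgClosed (ResidueField L⟦X⟧) :=
    IsAlgClosed.of_ringEquiv L _ PowerSeries.residueFieldOfPowerSeries.symm
  have h := map_residue_eq_X_pow_of_nextCoeff_eq_zero hP hirr
    (fun h => hdeg (by simpa using congrArg PowerSeries.residueFieldOfPowerSeries h)) hnext
  have hres : (PowerSeries.residueFieldOfPowerSeries (k := L)).toRingHom.comp (residue L⟦X⟧) =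
      PowerSeries.constantCoeff := rfl
  rw [← hres, ← map_map, h, Polynomial.map_pow, map_X]

end Hensel

section Ramify

variable {R : Type*} [CommRing R]

/-- Division by `d` from the exponents of `s` to those of `t = s ^ d`. -/
def divHom (d : ℕ+) : ℕ →+ ℚ where
  toFun n := n / d
  map_zero' := by simp
  map_add' a b := by rw [Nat.cast_add, add_div]

theorem divHom_strictMono (d : ℕ+) : StrictMono (divHom d) := fun _ _ h =>
  div_lt_div_of_pos_right (Nat.cast_lt.2 h) (Nat.cast_pos.2 d.pos)

/-- The substitution `s ↦ t ^ (1 / d)` from power series in `s` to fractional power series in `t`.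
It identifies `R⟦s⟧` with the fractional power series whose exponents have denominator `d`. -/
noncomputable def ramify (d : ℕ+) : R⟦X⟧ →+* FracPower R :=
  RingHom.codRestrict ((HahnSeries.embDomainRingHom (divHom d) (divHom_strictMono d).injective
    fun _ _ => (divHom_strictMono d).le_iff_le).comp
      (HahnSeries.toPowerSeries.symm : R⟦X⟧ ≃+* HahnSeries ℕ R).toRingHom) (FracPower R) fun f => by
    refine ⟨⟨d, d.pos, fun q hq => ?_⟩, fun q hq => by_contra fun h => ?_⟩
    · obtain ⟨n, -, rfl⟩ := HahnSeries.support_embDomain_subset hq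
      exact ⟨n, rfl⟩
    · obtain ⟨n, -, rfl⟩ := HahnSeries.support_embDomain_subset h
      exact hq.not_ge (div_nonneg n.cast_nonneg (Nat.cast_nonneg _))

theorem coeff_ramify (d : ℕ+) (f : R⟦X⟧) (n : ℕ) :
    (ramify d f : HahnSeries ℚ R).coeff (n / d) = PowerSeries.coeff n f :=
  HahnSeries.embDomain_coeff (f := ⟨⟨divHom d, _⟩, _⟩) (a := n)

theorem coeff_ramify_of_forall_ne (d : ℕ+) (f : R⟦X⟧) {q : ℚ} (hq : ∀ n : ℕ, q ≠ n / d) :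
    (ramify d f : HahnSeries ℚ R).coeff q = 0 :=
  HahnSeries.embDomain_of_notMem_range (f := ⟨⟨divHom d, _⟩, _⟩)
    fun ⟨n, hn⟩ => hq n hn.symm

theorem coeff_zero_ramify (d : ℕ+) (f : R⟦X⟧) :
    (ramify d f : HahnSeries ℚ R).coeff 0 = PowerSeries.constantCoeff f := by
  simpa using coeff_ramify d f 0

theorem ramify_injective (d : ℕ+) : Function.Injective (ramify d : R⟦X⟧ →+* FracPower R) :=
  fun f g h => PowerSeries.ext fun n => by rw [← coeff_ramify d, h, coeff_ramify]

theorem mem_range_ramify_iff {d : ℕ+} {x : FracPower R} :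
    x ∈ (ramify d : R⟦X⟧ →+* FracPower R).range ↔
      ∀ q : ℚ, (x : HahnSeries ℚ R).coeff q ≠ 0 → ∃ n : ℕ, q = n / d := by
  refine ⟨?_, fun hx => ⟨PowerSeries.mk fun n => (x : HahnSeries ℚ R).coeff (n / d), ?_⟩⟩
  · rintro ⟨f, rfl⟩ q hq
    contrapose! hq
    exact coeff_ramify_of_forall_ne d f hq
  · refine Subtype.ext (HahnSeries.ext (funext fun q => ?_))
    by_cases hq : ∃ n : ℕ, q = n / d
    · obtain ⟨n, rfl⟩ := hq
      rw [coeff_ramify, PowerSeries.coeff_mk]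
    · rw [coeff_ramify_of_forall_ne d _ (not_exists.1 hq), not_imp_comm.1 (hx q) hq]

theorem range_ramify_le_of_dvd {d e : ℕ+} (h : d ∣ e) :
    (ramify d : R⟦X⟧ →+* FracPower R).range ≤ (ramify e).range := by
  obtain ⟨k, rfl⟩ := h
  intro x hx
  refine mem_range_ramify_iff.2 fun q hq => ?_
  obtain ⟨n, rfl⟩ := mem_range_ramify_iff.1 hx q hq
  refine ⟨n * k, ?_⟩
  rw [PNat.mul_coe, Nat.cast_mul, Nat.cast_mul,
    mul_div_mul_right _ _ (Nat.cast_ne_zero.2 k.ne_zero)]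

theorem exists_mem_range_ramify (x : FracPower R) :
    ∃ d, x ∈ (ramify d : R⟦X⟧ →+* FracPower R).range := by
  obtain ⟨d, hd, hx⟩ := x.2.1
  refine ⟨⟨d, hd⟩, mem_range_ramify_iff.2 fun q hq => ?_⟩
  obtain ⟨n, rfl⟩ := hx q hq
  have hn : (0 : ℚ) ≤ n := not_lt.1 fun hlt =>
    hq (x.2.2 _ (div_neg_of_neg_of_pos hlt (Nat.cast_pos.2 hd)))
  lift n to ℕ using Int.cast_nonneg_iff.1 hn
  exact ⟨n, rfl⟩

theorem exists_map_ramify_eq (P : (FracPower R)[X]) :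
    ∃ d : ℕ+, ∀ e, d ∣ e → ∃ Q : R⟦X⟧[X], Q.map (ramify e) = P := by
  choose d hd using exists_mem_range_ramify (R := R)
  refine ⟨∏ i ∈ P.support, d (P.coeff i), fun e he => (mem_map_range _).2 fun i => ?_⟩
  by_cases hi : P.coeff i = 0
  · rw [hi]
    exact zero_mem _
  · exact range_ramify_le_of_dvd ((Finset.dvd_prod_of_mem (fun i => d (P.coeff i))
      (mem_support_iff.2 hi)).trans he) (hd _)

end Ramify

section Inclusion

variable {R : Type*} [CommRing R]

/-- The inclusion `R^fr[[t]] ⊂ R^fr((t))`. -/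
noncomputable def inclusion (R : Type*) [CommRing R] : FracPower R →+* FracLaurent R :=
  Subring.inclusion (fracPower_le_fracLaurent R)

theorem inclusion_injective : Function.Injective (inclusion R) :=
  Subring.inclusion_injective _

theorem mem_range_inclusion_iff {U : FracLaurent R} :
    U ∈ (inclusion R).range ↔ FiniteAtZero U :=
  ⟨fun ⟨x, hx⟩ => hx ▸ x.2.2, fun hU => ⟨⟨U, U.2, hU⟩, rfl⟩⟩

theorem VanishesAtZero.finiteAtZero {U : FracLaurent R} (hU : VanishesAtZero U) :
    FiniteAtZero U := fun q hq => hU q hq.le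

instance charZero_fracLaurent [CharZero R] : CharZero (FracLaurent R) :=
  have : CharZero (HahnSeries ℚ R) := charZero_of_injective_ringHom HahnSeries.C_injective
  inferInstance

end Inclusion

section NewtonPolygon

variable {R : Type*} [CommRing R]

theorem single_mem_fracLaurent (r : ℚ) (a : R) : HahnSeries.single r a ∈ FracLaurent R := by
  refine ⟨r.den, r.den_pos, fun q hq => ⟨r.num, ?_⟩⟩
  rw [Rat.num_div_den]
  exact not_imp_comm.1 HahnSeries.coeff_single_of_ne hq

/-- The monomial `t ^ r`, as a unit of the ring of fractional Laurent series. -/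
noncomputable def tPow (R : Type*) [CommRing R] (r : ℚ) : (FracLaurent R)ˣ where
  val := ⟨HahnSeries.single r 1, single_mem_fracLaurent r 1⟩
  inv := ⟨HahnSeries.single (-r) 1, single_mem_fracLaurent (-r) 1⟩
  val_inv := Subtype.ext (by simp)
  inv_val := Subtype.ext (by simp)

theorem coeff_mul_tPow_pow (x : FracLaurent R) (r q : ℚ) (n : ℕ) :
    ((x * tPow R r ^ n : FracLaurent R) : HahnSeries ℚ R).coeff q =
      (x : HahnSeries ℚ R).coeff (q - n * r) := by
  have hpow : ((tPow R r ^ n : FracLaurent R) : HahnSeries ℚ R) = HahnSeries.single (n * r) 1 := by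
    rw [SubmonoidClass.coe_pow, tPow, HahnSeries.single_pow, one_pow, nsmul_eq_mul]
  rw [MulMemClass.coe_mul, hpow]
  nth_rw 1 [← sub_add_cancel q (n * r)]
  rw [HahnSeries.coeff_mul_single_add, mul_one]

theorem exists_newton_slope {P : (FracLaurent R)[X]} (hP : P.Monic)
    (hX : P ≠ X ^ P.natDegree) :
    ∃ r : ℚ, (∀ i < P.natDegree, ∀ q < (P.natDegree - i : ℕ) * r,
        (P.coeff i : HahnSeries ℚ R).coeff q = 0) ∧
      ∃ i < P.natDegree, (P.coeff i : HahnSeries ℚ R).coeff ((P.natDegree - i : ℕ) * r) ≠ 0 := by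
  have hlead : P.eraseLead ≠ 0 := fun h => hX <| by
    simpa [h, hP.leadingCoeff] using P.eraseLead_add_C_mul_X_pow.symm
  have hpos {i : ℕ} (hi : i < P.natDegree) : (0 : ℚ) < (P.natDegree - i : ℕ) :=
    Nat.cast_pos.2 (Nat.sub_pos_of_lt hi)
  obtain ⟨j, hj, hmin⟩ := P.eraseLead.support.exists_min_image
    (fun i => (P.coeff i : HahnSeries ℚ R).order / (P.natDegree - i : ℕ))
    (support_nonempty.2 hlead)
  have hjn := lt_natDegree_of_mem_eraseLead_support hj
  refine ⟨(P.coeff j : HahnSeries ℚ R).order / (P.natDegree - j : ℕ),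
    fun i hi q hq => ?_, j, hjn, ?_⟩
  · by_cases hi0 : P.coeff i = 0
    · rw [hi0]
      rfl
    · have hle := hmin i (by simp [eraseLead_support, hi0, hi.ne])
      rw [le_div_iff₀' (hpos hi)] at hle
      exact HahnSeries.coeff_eq_zero_of_lt_order (hq.trans_le hle)
  · rw [mul_div_cancel₀ _ (hpos hjn).ne', Ne, HahnSeries.coeff_order_eq_zero]
    rw [eraseLead_support, Finset.mem_erase, mem_support_iff] at hj
    exact fun h => hj.2 (Subtype.ext h)

theorem exists_scaleRoots_finiteAtZero {P : (FracLaurent R)[X]} (hP : P.Monic)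
    (hX : P ≠ X ^ P.natDegree) :
    ∃ s : (FracLaurent R)ˣ, (∀ i, FiniteAtZero ((P.scaleRoots s).coeff i)) ∧
      ∃ i < P.natDegree, ((P.scaleRoots s).coeff i : HahnSeries ℚ R).coeff 0 ≠ 0 := by
  obtain ⟨r, hr, j, hj, hrj⟩ := exists_newton_slope hP hX
  refine ⟨tPow R (-r), fun i q hq => ?_, j, hj, ?_⟩
  · rw [coeff_scaleRoots, coeff_mul_tPow_pow]
    obtain hi | rfl | hi := lt_trichotomy i P.natDegree
    · exact hr i hi _ (by linarith)
    · simp [hP.leadingCoeff, HahnSeries.coeff_one, hq.ne]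
    · rw [coeff_eq_zero_of_natDegree_lt hi]
      rfl
  · rw [coeff_scaleRoots, coeff_mul_tPow_pow]
    simpa using hrj

end NewtonPolygon

section NewtonPuiseux

theorem exists_map_inclusion_ramify_eq {R : Type*} [CommRing R] {P : (FracLaurent R)[X]}
    (hP : ∀ i, FiniteAtZero (P.coeff i)) :
    ∃ (d : ℕ+) (Q : R⟦X⟧[X]), Q.map ((inclusion R).comp (ramify d)) = P := by
  obtain ⟨P, rfl⟩ := (mem_map_range _).2 fun i => mem_range_inclusion_iff.2 (hP i)
  obtain ⟨d, hd⟩ := exists_map_ramify_eq P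
  obtain ⟨Q, rfl⟩ := hd d dvd_rfl
  exact ⟨d, Q, (Polynomial.map_map _ _ _).symm⟩

variable {L : Type*} [Field L] [IsAlgClosed L]

theorem eq_X_pow_of_irreducible_of_nextCoeff_eq_zero {P : (FracLaurent L)[X]} (hP : P.Monic)
    (hirr : Irreducible P) (hdeg : (P.natDegree : L) ≠ 0) (hnext : P.nextCoeff = 0) :
    P = X ^ P.natDegree := by
  by_contra hX
  obtain ⟨s, hfin, i, hi, hi0⟩ := exists_scaleRoots_finiteAtZero hP hX
  obtain ⟨d, Q, hQ⟩ := exists_map_inclusion_ramify_eq hfin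
  have hinj : Function.Injective ((inclusion L).comp (ramify d)) :=
    inclusion_injective.comp (ramify_injective d)
  have hQdeg : Q.natDegree = P.natDegree := by
    rw [← natDegree_map_eq_of_injective hinj, hQ, natDegree_scaleRoots]
  have hQmonic : Q.Monic :=
    hinj.monic_map_iff.2 (hQ ▸ (monic_scaleRoots_iff _).2 hP)
  have hQirr : Irreducible Q := hQmonic.irreducible_of_irreducible_map _ _ <| by
    rw [hQ]
    exact (irreducible_scaleRoots_iff s.isUnit).2 hirr
  have hQnext : Q.nextCoeff = 0 := hinj <| by
    rw [← nextCoeff_map hinj, hQ, nextCoeff_scaleRoots, hnext, zero_mul, map_zero]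
  have hQcoeff : PowerSeries.constantCoeff (Q.coeff i) = 0 := by
    rw [← coeff_map, map_constantCoeff_eq_X_pow_of_irreducible hQmonic hQirr (hQdeg ▸ hdeg) hQnext,
      coeff_X_pow, if_neg (hQdeg ▸ hi.ne)]
  refine hi0 ?_
  rw [← hQ, coeff_map, ← hQcoeff, ← coeff_zero_ramify d]
  rfl

instance isAlgClosed_fracLaurent [CharZero L] : IsAlgClosed (FracLaurent L) :=
  IsAlgClosed.of_exists_root _ fun P hP hirr => by
    have hdeg : P.natDegree ≠ 0 := hirr.natDegree_pos.ne'
    obtain ⟨c, hc⟩ := exists_nextCoeff_taylor_eq_zero (P := P) (Nat.cast_ne_zero.2 hdeg)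
    have hpow := eq_X_pow_of_irreducible_of_nextCoeff_eq_zero
      ((leadingCoeff_taylor _ _).trans hP) (irreducible_taylor_iff.2 hirr)
      (by rw [natDegree_taylor]; exact Nat.cast_ne_zero.2 hdeg) hc
    refine ⟨c, ?_⟩
    rw [← zero_add c, ← taylor_eval, hpow, natDegree_taylor]
    simp [hdeg]

end NewtonPuiseux

section SquareRoot

variable {R : Type*} [CommRing R]

/-- Exchanging the two variables of an iterated power series. A square root in `R[[u]]^fr[[t]]` is,
after ramification, a power series in `t` over `R⟦u⟧`, whereas Weierstrass division by `u - U(t)`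
takes place among the power series in `u` over `R⟦t⟧`. -/
noncomputable def swapVariables (R : Type*) [CommRing R] : R⟦X⟧⟦X⟧ →+* R⟦X⟧⟦X⟧ where
  toFun f := PowerSeries.mk fun n => PowerSeries.mk fun m =>
    PowerSeries.coeff n (PowerSeries.coeff m f)
  map_one' := by
    ext n m
    by_cases hn : n = 0 <;> by_cases hm : m = 0 <;> simp [PowerSeries.coeff_one, hn, hm]
  map_mul' f g := by
    ext n m
    simp only [PowerSeries.coeff_mk, PowerSeries.coeff_mul, map_sum]
    exact Finset.sum_comm
  map_zero' := by ext; simp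
  map_add' f g := by ext; simp

theorem coeff_coeff_swapVariables (f : R⟦X⟧⟦X⟧) (n m : ℕ) :
    PowerSeries.coeff m (PowerSeries.coeff n (swapVariables R f)) =
      PowerSeries.coeff n (PowerSeries.coeff m f) := by
  simp [swapVariables]

theorem swapVariables_eq_coe {d : ℕ+} {f : R⟦X⟧⟦X⟧} {P : R⟦X⟧[X]}
    (h : ramify d f = toPowerSeriesSeries R (P.map (ramify d))) : swapVariables R f = P := by
  ext n m
  rw [coeff_coeff_swapVariables, ← coeff_ramify d f, h, coeff_toPowerSeriesSeries, coeff_map,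
    coeff_ramify, coeff_coe]

theorem even_rootMultiplicity_of_sq_eq_toPowerSeriesSeries [IsDomain R] {P : (FracPower R)[X]}
    (hP : P ≠ 0) {δ : FracPower R⟦X⟧} (hδ : δ ^ 2 = toPowerSeriesSeries R P) {U : FracPower R}
    (hU : (U : HahnSeries ℚ R).coeff 0 = 0) : Even (P.rootMultiplicity U) := by
  obtain ⟨d₁, h₁⟩ := exists_map_ramify_eq P
  obtain ⟨d₂, h₂⟩ := exists_mem_range_ramify δ
  obtain ⟨d₃, h₃⟩ := exists_mem_range_ramify U
  obtain ⟨d, hd₁, hd₂, hd₃⟩ : ∃ d, d₁ ∣ d ∧ d₂ ∣ d ∧ d₃ ∣ d :=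
    ⟨d₁ * d₂ * d₃, (dvd_mul_right _ _).mul_right _, (dvd_mul_left _ _).mul_right _,
      dvd_mul_left _ _⟩
  obtain ⟨P, rfl⟩ := h₁ d hd₁
  obtain ⟨δ, rfl⟩ := range_ramify_le_of_dvd hd₂ h₂
  obtain ⟨U, rfl⟩ := range_ramify_le_of_dvd hd₃ h₃
  rw [← eq_rootMultiplicity_map (ramify_injective d)]
  rw [coeff_zero_ramify, ← PowerSeries.X_dvd_iff, ← Ideal.mem_span_singleton] at hU
  rw [← map_pow (ramify d)] at hδ
  have hsq : swapVariables R δ ^ 2 = P := by rw [← map_pow, swapVariables_eq_coe hδ]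
  exact even_rootMultiplicity_of_sq_eq_coe (fun h => hP (by rw [h, Polynomial.map_zero])) hsq hU

theorem map_taylor_toPolySeries (c : R) (P : (FracPower R)[X]) :
    FracPower.map (taylorAlgHom c).toRingHom (toPolySeries R P) =
      toPolySeries R (taylor (FracPower.const c) P) := by
  suffices h : (FracPower.map (taylorAlgHom c).toRingHom).comp (toPolySeries R) =
      (toPolySeries R).comp (taylorAlgHom (FracPower.const c)).toRingHom from
    RingHom.congr_fun h P
  refine ringHom_ext (fun a => Subtype.ext (HahnSeries.ext (funext fun q => ?_)))
    (Subtype.ext (HahnSeries.ext (funext fun q => ?_)))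
  · simp [toPolySeries, FracPower.map]
  · by_cases hq : q = 0 <;>
      simp [toPolySeries, FracPower.map, FracPower.const, HahnSeries.coeff_single_of_ne, hq]

theorem even_rootMultiplicity_of_sq_eq_toPolySeries [IsDomain R] {P : (FracPower R)[X]}
    (hP : P ≠ 0) {δ : FracPower R[X]} (hδ : δ ^ 2 = toPolySeries R P) (U : FracPower R) :
    Even (P.rootMultiplicity U) := by
  let c := (U : HahnSeries ℚ R).coeff 0
  have hsq : FracPower.map coeToPowerSeries.ringHom
      (FracPower.map (taylorAlgHom c).toRingHom δ) ^ 2 =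
        toPowerSeriesSeries R (taylor (FracPower.const c) P) := by
    rw [← map_pow, ← map_pow, hδ, map_taylor_toPolySeries]
    rfl
  rw [← rootMultiplicity_taylor P (FracPower.const c)]
  exact even_rootMultiplicity_of_sq_eq_toPowerSeriesSeries
    ((taylor_injective _).ne_iff' (map_zero _) |>.2 hP) hsq (by simp [FracPower.const, c])

end SquareRoot

section BaseChange

variable {R S : Type*} [CommRing R] [CommRing S]

theorem coeff_fracPower_map (f : R →+* S) (x : FracPower R) (q : ℚ) :
    (FracPower.map f x : HahnSeries ℚ S).coeff q = f ((x : HahnSeries ℚ R).coeff q) := rfl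

theorem map_toPolySeries (f : R →+* S) (P : (FracPower R)[X]) :
    FracPower.map (mapRingHom f) (toPolySeries R P) =
      toPolySeries S (P.map (FracPower.map f)) := by
  refine Subtype.ext (HahnSeries.ext (funext fun q => Polynomial.ext fun n => ?_))
  rw [coeff_fracPower_map, coeff_toPolySeries, coe_mapRingHom, coeff_map,
    coeff_toPolySeries, coeff_map, coeff_fracPower_map]

theorem map_toPowerSeriesSeries (f : R →+* S) (P : (FracPower R)[X]) :
    FracPower.map (PowerSeries.map f) (toPowerSeriesSeries R P) =
      toPowerSeriesSeries S (P.map (FracPower.map f)) := by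
  refine Subtype.ext (HahnSeries.ext (funext fun q => PowerSeries.ext fun n => ?_))
  rw [coeff_fracPower_map, coeff_toPowerSeriesSeries, PowerSeries.coeff_map,
    coeff_toPowerSeriesSeries, coeff_map, coeff_fracPower_map]

theorem fracPower_map_injective {f : R →+* S} (hf : Function.Injective f) :
    Function.Injective (FracPower.map f) := fun x y h =>
  Subtype.ext (HahnSeries.ext (funext fun q => hf (by
    rw [← coeff_fracPower_map, h, coeff_fracPower_map])))

variable {K L : Type*} [Field K] [Field L] [Algebra K L]

theorem rootMultiplicity_map_toFracLaurent (Δ : (FracPower K)[X]) (U : FracPower L) :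
    (Δ.map (toFracLaurent K L)).rootMultiplicity (inclusion L U) =
      (Δ.map (FracPower.map (algebraMap K L))).rootMultiplicity U := by
  rw [eq_rootMultiplicity_map inclusion_injective, Polynomial.map_map]
  rfl

theorem even_rootMultiplicity_of_vanishesAtZero {Δ : (FracPower K)[X]} (hΔ : Δ ≠ 0)
    {δ : FracPower K⟦X⟧} (hδ : δ ^ 2 = toPowerSeriesSeries K Δ) {U : FracLaurent L}
    (hU : VanishesAtZero U) : Even ((Δ.map (toFracLaurent K L)).rootMultiplicity U) := by
  obtain ⟨U, rfl⟩ := mem_range_inclusion_iff.2 hU.finiteAtZero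
  rw [rootMultiplicity_map_toFracLaurent]
  refine even_rootMultiplicity_of_sq_eq_toPowerSeriesSeries
    ((Polynomial.map_ne_zero_iff (fracPower_map_injective (algebraMap K L).injective)).2 hΔ)
    (δ := FracPower.map (PowerSeries.map (algebraMap K L)) δ) ?_ (hU 0 le_rfl)
  rw [← map_pow, hδ, map_toPowerSeriesSeries]

theorem even_rootMultiplicity_of_finiteAtZero {Δ : (FracPower K)[X]} (hΔ : Δ ≠ 0)
    {δ : FracPower K[X]} (hδ : δ ^ 2 = toPolySeries K Δ) {U : FracLaurent L}
    (hU : FiniteAtZero U) : Even ((Δ.map (toFracLaurent K L)).rootMultiplicity U) := by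
  obtain ⟨U, rfl⟩ := mem_range_inclusion_iff.2 hU
  rw [rootMultiplicity_map_toFracLaurent]
  refine even_rootMultiplicity_of_sq_eq_toPolySeries
    ((Polynomial.map_ne_zero_iff (fracPower_map_injective (algebraMap K L).injective)).2 hΔ)
    (δ := FracPower.map (mapRingHom (algebraMap K L)) δ) ?_ U
  rw [← map_pow, hδ, map_toPolySeries]

end BaseChange

end FractionalSeries

theorem mainTheorem12_general {K L : Type*} [Field K] [Field L] [Algebra K L] [IsAlgClosed L]
    [CharZero L] (Δ : Polynomial (FracPower K)) (hΔ : Δ ≠ 0) :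
    (Δ.map (toFracLaurent K L)).Splits ∧
    ((∃ δ : FracPower (PowerSeries K), δ ^ 2 = toPowerSeriesSeries K Δ) →
      ∀ U : FracLaurent L, VanishesAtZero U →
        Even ((Δ.map (toFracLaurent K L)).rootMultiplicity U)) ∧
    ((∃ δ : FracPower (Polynomial K), δ ^ 2 = toPolySeries K Δ) →
      ∀ U : FracLaurent L, FiniteAtZero U →
        Even ((Δ.map (toFracLaurent K L)).rootMultiplicity U)) :=
  ⟨IsAlgClosed.splits _,
    fun ⟨_, hδ⟩ _ hU => even_rootMultiplicity_of_vanishesAtZero hΔ hδ hU,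
    fun ⟨_, hδ⟩ _ hU => even_rootMultiplicity_of_finiteAtZero hΔ hδ hU⟩

theorem mainTheorem12 {K : Type*} [Field K] [CharZero K]
    {Kbar : Type*} [Field Kbar] [Algebra K Kbar] [IsAlgClosure K Kbar]
    (Δ : Polynomial (FracPower K)) (hΔ : Δ ≠ 0) :
    (Δ.map (toFracLaurent K Kbar)).Splits ∧
    ((∃ δ : FracPower (PowerSeries K), δ ^ 2 = toPowerSeriesSeries K Δ) →
      ∀ U : FracLaurent Kbar, (Δ.map (toFracLaurent K Kbar)).IsRoot U → VanishesAtZero U →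
        Even ((Δ.map (toFracLaurent K Kbar)).rootMultiplicity U)) ∧
    ((∃ δ : FracPower (Polynomial K), δ ^ 2 = toPolySeries K Δ) →
      ∀ U : FracLaurent Kbar, (Δ.map (toFracLaurent K Kbar)).IsRoot U → FiniteAtZero U →
        Even ((Δ.map (toFracLaurent K Kbar)).rootMultiplicity U)) := by
  have : IsAlgClosed Kbar := IsAlgClosure.isAlgClosed K
  have : CharZero Kbar := charZero_of_injective_algebraMap (algebraMap K Kbar).injective
  obtain ⟨hsplits, hvanishes, hfinite⟩ := mainTheorem12_general (L := Kbar) Δ hΔ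
  exact ⟨hsplits, fun hδ U _ => hvanishes hδ U, fun hδ U _ => hfinite hδ U⟩
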